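/- **Theorem 5.1.** All vertex operator algebras (VOAs) are over $\mathbb{C}$, are graded by the integral eigenvalues of $L(0)$, and have finite-dimensional homogeneous spaces, which vanish in sufficiently negative weight. We write $Y(u,z)=\sum_{n\in\mathbb{Z}}u(n)z^{-n-1}$. A VOA is *self-dual* if it admits a nonzero bilinear form $(\ ,\ )$ that is invariant, i.e. $(Y(u,z)v,w)=(v,Y(e^{zL(1)}(-z^{-2})^{L(0)}u,z^{-1})w)$; it is of *CFT-type* if its weight zero space is $\mathbb{C}\mathbf{1}$; it is *$\mathbb{N}$-graded* if it has no nonzero states of negative weight. Let $(W,h,V)$ be a *shifted triple*: $W=(W,Y,\mathbf{1},\omega')$ is a self-dual VOA of CFT-type with $Y(\omega',z)=\sum_n L'(n)z^{-n-2}$, $h\in W_1$, and $V=W^h=(W,Y,\mathbf{1},\omega'+L'(-1)h)$ (same space, fields and vacuum) is a simple, self-dual, $\mathbb{N}$-graded VOA. Regard the weight zero space $V_0$ of $V$ as an algebra with product $ab=a(-1)b$. Then $h(0)$ preserves $V_0$. For $\lambda\in\mathbb{C}$ let $A^\lambda=\{v\in V_0 : h(0)v=\lambda v\}$; it coincides with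 $W_{\lambda,\lambda}=\{w\in W : L'(0)w=\lambda w,\ h(0)w=\lambda w\}$. The following hold. 1. $V_0=\bigoplus_{\lambda}A^\lambda$, and if $A^\lambda\neq 0$ then $\lambda$ is a nonnegative integer. 2. $A^0=\mathbb{C}\mathbf{1}$. 3. $h(1)h=\frac{\nu}{2}\mathbf{1}$ for some scalar $\nu\in\mathbb{C}$, and for this $\nu$, $A^\nu=T=\mathbb{C}t$ with $t\ne 0$, where $T$ is the unique minimal nonzero ideal of $V_0$ (it is contained in every nonzero ideal of $V_0$). 4. $A^\lambda(-1)A^\mu\subseteq A^{\lambda+\mu}$ for all $\lambda,\mu$. 5. For every nonzero invariant bilinear form $(\ ,\ )$ on $V$: $(A^\lambda,A^\mu)=0$ if $\lambda+\mu\neq\nu$. 6. For every nonzero invariant bilinear form $(\ ,\ )$ on $V$: if $\lambda+\mu=\nu$, then $(\ ,\ )$ restricts to a perfect pairing $A^\lambda\times A^\mu\to\mathbb{C}$. -/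

import Mathlib

/-- A vertex algebra over `ℂ`: a state-field map `Y` into the vertex operators
(so that `u(n)v = 0` for `n` large, where `u(n)` is the coefficient of `z^(-n-1)` in `Y(u, z)`)
and a vacuum vector, subject to the vacuum, creation and Jacobi (Borcherds) identities. -/
structure VertexAlgebra (V : Type*) [AddCommGroup V] [Module ℂ V] where
  /-- The state-field correspondence `u ↦ Y(u, z)`. -/
  Y : V →ₗ[ℂ] VertexOperator ℂ V
  /-- The vacuum vector. -/
  vac : V
  vacuum : ∀ (n : ℤ) (v : V),
    VertexOperator.ncoeff (Y vac) n v = if n = -1 then v else 0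
  creation : ∀ v : V, VertexOperator.ncoeff (Y v) (-1) vac = v
  creation_nonneg : ∀ (v : V) (n : ℤ), 0 ≤ n → VertexOperator.ncoeff (Y v) n vac = 0
  /-- The Jacobi identity, written in modes; all three sums are finite by truncation. -/
  jacobi : ∀ (u v w : V) (l m n : ℤ),
    (∑ᶠ i : ℕ, Ring.choose m i •
        VertexOperator.ncoeff (Y (VertexOperator.ncoeff (Y u) (l + i) v)) (m + n - i) w) =
      (∑ᶠ i : ℕ, ((-1 : ℤ) ^ i * Ring.choose l i) •
        VertexOperator.ncoeff (Y u) (l + m - i) (VertexOperator.ncoeff (Y v) (n + i) w)) -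
      (∑ᶠ i : ℕ, ((l.negOnePow : ℤ) * (-1 : ℤ) ^ i * Ring.choose l i) •
        VertexOperator.ncoeff (Y v) (l + n - i) (VertexOperator.ncoeff (Y u) (m + i) w))

namespace VertexAlgebra

variable {V : Type*} [AddCommGroup V] [Module ℂ V]

/-- The mode `u(n)`, where `Y(u, z) = ∑ u(n) z^(-n-1)`. -/
noncomputable def mode (U : VertexAlgebra V) (u : V) (n : ℤ) : Module.End ℂ V :=
  VertexOperator.ncoeff (U.Y u) n

/-- The operator `L(n) = ω(n+1)`, i.e. `Y(ω, z) = ∑ L(n) z^(-n-2)`. -/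
noncomputable def vir (U : VertexAlgebra V) (ω : V) (n : ℤ) : Module.End ℂ V :=
  U.mode ω (n + 1)

/-- The space of conformal weight `n`: the `n`-eigenspace of `L(0)`. -/
noncomputable def weightSpace (U : VertexAlgebra V) (ω : V) (n : ℤ) : Submodule ℂ V :=
  Module.End.eigenspace (U.vir ω 0) (n : ℂ)

/-- `(V, Y, 1, ω)` is a vertex operator algebra: the modes of `ω` satisfy the Virasoro relations
for some central charge, `Y(L(-1)v, z)` is the derivative of `Y(v, z)`, and `V` is the direct sum
of the `L(0)`-eigenspaces with integral eigenvalues, which are finite-dimensional and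
vanish for sufficiently negative weight. -/
structure IsVOA (U : VertexAlgebra V) (ω : V) : Prop where
  virasoro : ∃ c : ℂ, ∀ m n : ℤ,
    U.vir ω m * U.vir ω n - U.vir ω n * U.vir ω m =
      ((m : ℂ) - n) • U.vir ω (m + n) +
        (if m + n = 0 then ((m : ℂ) ^ 3 - m) / 12 * c else 0) • (1 : Module.End ℂ V)
  derivative : ∀ (v : V) (n : ℤ), U.mode (U.vir ω (-1) v) n = (-(n : ℂ)) • U.mode v (n - 1)
  grading : DirectSum.IsInternal (U.weightSpace ω)
  finite : ∀ n : ℤ, FiniteDimensional ℂ (U.weightSpace ω n)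
  bounded : ∃ N : ℤ, ∀ n : ℤ, n < N → U.weightSpace ω n = ⊥

/-- Simplicity: `V` is nonzero and has no subspaces invariant under all modes
besides `0` and `V`. -/
def IsSimple (U : VertexAlgebra V) : Prop :=
  Nontrivial V ∧
    ∀ I : Submodule ℂ V, (∀ (u : V) (n : ℤ), ∀ x ∈ I, U.mode u n x ∈ I) → I = ⊥ ∨ I = ⊤

/-- Invariance of a bilinear form with respect to the conformal vector `ω`:
`(Y(u, z)v, w) = (v, Y(e^{zL(1)} (-z⁻²)^{L(0)} u, z⁻¹)w)`.
For `u` of weight `k`, comparing the coefficients of `z^(-n-1)` gives the identity below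
(a finite sum, since `L(1)` lowers weights by one). -/
def IsInvariant (U : VertexAlgebra V) (ω : V) (B : LinearMap.BilinForm ℂ V) : Prop :=
  ∀ (k : ℤ), ∀ u ∈ U.weightSpace ω k, ∀ (n : ℤ) (v w : V),
    B (U.mode u n v) w =
      ∑ᶠ i : ℕ, ((-1 : ℂ) ^ k / (i.factorial : ℂ)) *
        B v (U.mode ((U.vir ω 1 ^ i) u) (2 * k - n - 2 - i) w)

/-- Self-duality: there is a nonzero invariant bilinear form. -/
def IsSelfDual (U : VertexAlgebra V) (ω : V) : Prop :=
  ∃ B : LinearMap.BilinForm ℂ V, B ≠ 0 ∧ U.IsInvariant ω B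

/-- CFT-type: the weight zero space is spanned by the vacuum. -/
def IsCFTType (U : VertexAlgebra V) (ω : V) : Prop :=
  U.weightSpace ω 0 = Submodule.span ℂ {U.vac}

/-- `ℕ`-graded: there are no nonzero states of negative weight. -/
def IsNGraded (U : VertexAlgebra V) (ω : V) : Prop :=
  ∀ n : ℤ, n < 0 → U.weightSpace ω n = ⊥

/-- The shifted vector `ω'_h = ω' + L'(-1)h`. -/
noncomputable def shift (U : VertexAlgebra V) (ω' h : V) : V :=
  ω' + U.vir ω' (-1) h

/-- `(W, h, V)` is a shifted triple, where `W = (U, ω')` and `V = W^h = (U, ω'_h)` share the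
underlying space, the fields and the vacuum. -/
structure IsShiftedTriple (U : VertexAlgebra V) (ω' h : V) : Prop where
  isVOA_W : U.IsVOA ω'
  selfDual_W : U.IsSelfDual ω'
  cftType_W : U.IsCFTType ω'
  mem_W_one : h ∈ U.weightSpace ω' 1
  isVOA_V : U.IsVOA (U.shift ω' h)
  simple_V : U.IsSimple
  selfDual_V : U.IsSelfDual (U.shift ω' h)
  nGraded_V : U.IsNGraded (U.shift ω' h)

/-- `W_{p,q}`: the simultaneous eigenspace `L'(0)w = pw`, `h(0)w = qw`. -/
noncomputable def jointEigenspace (U : VertexAlgebra V) (ω' h : V) (p q : ℂ) : Submodule ℂ V :=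
  Module.End.eigenspace (U.vir ω' 0) p ⊓ Module.End.eigenspace (U.mode h 0) q

/-- `A^p`: the `p`-eigenspace of `h(0)` on the weight zero space `V_0` of `V = W^h`. -/
noncomputable def deRham (U : VertexAlgebra V) (ω' h : V) (p : ℂ) : Submodule ℂ V :=
  U.weightSpace (U.shift ω' h) 0 ⊓ Module.End.eigenspace (U.mode h 0) p

/-- `I` is an ideal of the algebra `V_0` with product `ab = a(-1)b`. -/
def IsZeroIdeal (U : VertexAlgebra V) (ω : V) (I : Submodule ℂ V) : Prop :=
  I ≤ U.weightSpace ω 0 ∧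
    ∀ a ∈ U.weightSpace ω 0, ∀ x ∈ I, U.mode a (-1) x ∈ I ∧ U.mode x (-1) a ∈ I

end VertexAlgebra

/-! The shifted `L(0)` is `L'(0) - h(0)`, so `V_0` is the subspace where `L'(0)` and `h(0)` agree.
Hence `h(0)` inherits diagonalizability and integral eigenvalues from `L'(0)`. The eigenvalues are
nonnegative because CFT-type plus an `sl₂` argument excludes negative weights in `W`
(`isNGraded_of_isCFTType`), and eigenvalue `0` leaves only the vacuum line. Multiplicativity holds
because `h(0)` is a derivation.

Duality comes from `h` failing to be quasi-primary in `V`: `L'(1)h = 0` by self-duality of `W`, so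
the shifted `L(1)h` is `-2 h(1)h = -ν 1` (`vir_one_self`). In the invariance identity for `h(0)`
this correction becomes the extra term `ν (v, w)` (`apply_mode_zero`), which forces `p + q = ν` for
a nonzero pairing of `A^p` with `A^q`. Simplicity kills both radicals of the form, so these pairings
are perfect.

Thus `A^ν` is dual to `A^0`, hence a line, and nothing lies above degree `ν`, since its dual would
have negative degree. So `A^ν` is an ideal. Any nonzero ideal reaches it: multiplying an element by
a partner of its lowest component pushes all higher components beyond degree `ν`. -/

namespace Module.End

variable {K V : Type*} [Field K] [AddCommGroup V] [Module K V]

/-- If `f` is diagonalizable and `g` commutes with `f`, then `f` is diagonalizable on every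
eigenspace of `g`. -/
lemma eigenspace_le_iSup_inf_of_commute {f g : Module.End K V} (hfg : Commute f g)
    (hf : ⨆ p : K, f.eigenspace p = ⊤) (q : K) :
    g.eigenspace q ≤ ⨆ p : K, f.eigenspace p ⊓ g.eigenspace q := by
  classical
  intro x hx
  have hx' : x ∈ ⨆ p : K, f.eigenspace p := hf ▸ Submodule.mem_top
  obtain ⟨c, hc, rfl⟩ := (Submodule.mem_iSup_iff_exists_finsupp _ _).1 hx'
  refine (Submodule.mem_iSup_iff_exists_finsupp _ _).2 ⟨c, fun p => ⟨hc p, ?_⟩, rfl⟩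
  -- Commutation keeps each defect in its own `f`-eigenspace. The defects sum to zero, so
  -- independence of the eigenspaces makes each of them vanish.
  have hd : ∀ p, g (c p) - q • c p ∈ f.eigenspace p := by
    intro p
    have h1 := mem_eigenspace_iff.1 (hc p)
    have h2 : f (g (c p)) = g (f (c p)) := LinearMap.congr_fun hfg (c p)
    rw [mem_eigenspace_iff, map_sub, map_smul, h2, h1, map_smul, smul_sub, smul_comm q p]
  have hsum : ∑ i ∈ c.support, (g (c i) - q • c i) = 0 := by
    rw [mem_eigenspace_iff] at hx
    rw [Finset.sum_sub_distrib, ← map_sum, ← Finset.smul_sum, sub_eq_zero]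
    exact hx
  by_cases hp : p ∈ c.support
  · have hdis := (iSupIndep_def.1 f.eigenspaces_iSupIndep) p
    rw [Submodule.disjoint_def] at hdis
    have h0 := hdis _ (hd p) (by
      rw [← Finset.add_sum_erase _ _ hp] at hsum
      rw [eq_neg_of_add_eq_zero_left hsum]
      refine neg_mem (sum_mem fun i hi => ?_)
      exact Submodule.mem_iSup_of_mem i
        (Submodule.mem_iSup_of_mem (Finset.ne_of_mem_erase hi) (hd i)))
    exact mem_eigenspace_iff.2 (sub_eq_zero.1 h0)
  · rw [Finsupp.notMem_support_iff.1 hp]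
    exact zero_mem _

end Module.End

namespace VertexAlgebra

open Module.End

variable {V : Type*} [AddCommGroup V] [Module ℂ V] (U : VertexAlgebra V)

/-! ### Modes and commutator formulas -/

section Modes

lemma mode_add (u v : V) (n : ℤ) : U.mode (u + v) n = U.mode u n + U.mode v n := by
  simp [mode]

lemma mode_smul (c : ℂ) (u : V) (n : ℤ) : U.mode (c • u) n = c • U.mode u n := by
  simp [mode]

lemma mode_zero (n : ℤ) : U.mode 0 n = 0 := by
  simp [mode]

lemma mode_vac (n : ℤ) (v : V) : U.mode U.vac n v = if n = -1 then v else 0 :=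
  U.vacuum n v

lemma mode_apply_vac (v : V) : U.mode v (-1) U.vac = v :=
  U.creation v

lemma mode_apply_vac_of_nonneg (v : V) {n : ℤ} (hn : 0 ≤ n) : U.mode v n U.vac = 0 :=
  U.creation_nonneg v n hn

/-- The commutator formula. -/
lemma commutator (u v w : V) (m n : ℤ) :
    (∑ᶠ i : ℕ, Ring.choose m i • U.mode (U.mode u i v) (m + n - i) w) =
      U.mode u m (U.mode v n w) - U.mode v n (U.mode u m w) := by
  have h := U.jacobi u v w 0 m n
  simp only [← mode.eq_1, zero_add] at h
  rw [h, finsum_eq_single _ 0, finsum_eq_single _ 0]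
  · simp
  · intro i hi
    simp [Ring.choose_zero_pos ℤ (Nat.pos_of_ne_zero hi)]
  · intro i hi
    simp [Ring.choose_zero_pos ℤ (Nat.pos_of_ne_zero hi)]

lemma commutator_zero (u v w : V) (n : ℤ) :
    U.mode (U.mode u 0 v) n w = U.mode u 0 (U.mode v n w) - U.mode v n (U.mode u 0 w) := by
  rw [← U.commutator, finsum_eq_single _ 0]
  · simp
  · intro i hi
    simp [Ring.choose_zero_pos ℤ (Nat.pos_of_ne_zero hi)]

lemma commutator_one (u v w : V) (n : ℤ) :
    U.mode (U.mode u 0 v) (n + 1) w + U.mode (U.mode u 1 v) n w =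
      U.mode u 1 (U.mode v n w) - U.mode v n (U.mode u 1 w) := by
  rw [← U.commutator, finsum_eq_sum_of_support_subset (s := {0, 1})]
  · simp [add_comm]
  · intro i hi
    by_contra hi'
    apply hi
    have h2 : Ring.choose (1 : ℤ) i = 0 := by
      have := Ring.choose_natCast (R := ℤ) 1 i
      rw [Nat.cast_one] at this
      rw [this, Nat.choose_eq_zero_of_lt, Nat.cast_zero]
      simp only [Finset.coe_insert, Finset.coe_singleton, Set.mem_insert_iff,
        Set.mem_singleton_iff] at hi'
      omega
    simp only [h2, zero_smul]

end Modes

lemma vac_ne_zero [Nontrivial V] : U.vac ≠ 0 := by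
  intro h0
  obtain ⟨v, hv⟩ := exists_ne (0 : V)
  apply hv
  have := U.mode_vac (-1) v
  rw [h0, mode_zero] at this
  simpa using this.symm

variable {U}

lemma mem_weightSpace {ω v : V} {n : ℤ} :
    v ∈ U.weightSpace ω n ↔ U.vir ω 0 v = (n : ℂ) • v :=
  mem_eigenspace_iff

lemma mem_weightSpace_zero {ω v : V} : v ∈ U.weightSpace ω 0 ↔ U.vir ω 0 v = 0 := by
  simp [mem_weightSpace]

lemma vac_mem_weightSpace (ω : V) : U.vac ∈ U.weightSpace ω 0 :=
  mem_weightSpace_zero.2 (U.mode_apply_vac_of_nonneg ω (by norm_num))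

lemma vir_apply_vac (ω : V) {n : ℤ} (hn : -1 ≤ n) : U.vir ω n U.vac = 0 :=
  U.mode_apply_vac_of_nonneg ω (by omega)

lemma vir_neg_two_vac (ω : V) : U.vir ω (-2) U.vac = ω := by
  simp [vir, mode_apply_vac]

/-! ### Conformal weights and the Virasoro action -/

namespace IsVOA

variable {ω : V} (hV : U.IsVOA ω)

include hV

lemma iSup_weightSpace : ⨆ n, U.weightSpace ω n = ⊤ :=
  hV.grading.submodule_iSup_eq_top

lemma iSup_eigenspace : ⨆ p : ℂ, (U.vir ω 0).eigenspace p = ⊤ :=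
  top_unique (hV.iSup_weightSpace.symm.le.trans
    (iSup_le fun n => le_iSup (U.vir ω 0).eigenspace (n : ℂ)))

lemma vir_comm (m n : ℤ) (hmn : m + n ≠ 0) (v : V) :
    U.vir ω m (U.vir ω n v) = U.vir ω n (U.vir ω m v) + ((m : ℂ) - n) • U.vir ω (m + n) v := by
  obtain ⟨c, hc⟩ := hV.virasoro
  have h := LinearMap.congr_fun (hc m n) v
  simp only [hmn, if_false, zero_smul, add_zero, LinearMap.sub_apply, Module.End.mul_apply,
    LinearMap.smul_apply] at h
  rw [← h]; abel

lemma vir_one_comm (v : V) :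
    U.vir ω 1 (U.vir ω (-1) v) = U.vir ω (-1) (U.vir ω 1 v) + (2 : ℂ) • U.vir ω 0 v := by
  obtain ⟨c, hc⟩ := hV.virasoro
  have h := LinearMap.congr_fun (hc 1 (-1)) v
  simp only [LinearMap.sub_apply, Module.End.mul_apply, LinearMap.add_apply,
    LinearMap.smul_apply] at h
  norm_num at h
  rw [← h]; abel

lemma vir_mem {k : ℤ} {v : V} (hv : v ∈ U.weightSpace ω k) (m : ℤ) :
    U.vir ω m v ∈ U.weightSpace ω (k - m) := by
  rcases eq_or_ne m 0 with rfl | hm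
  · rw [sub_zero, mem_weightSpace.1 hv]
    exact Submodule.smul_mem _ _ hv
  · rw [mem_weightSpace] at hv ⊢
    rw [hV.vir_comm 0 m (by omega), hv, map_smul, zero_add, ← add_smul]
    congr 1
    push_cast
    ring

lemma pow_vir_one_mem {k : ℤ} {v : V} (hv : v ∈ U.weightSpace ω k) (i : ℕ) :
    (U.vir ω 1 ^ i) v ∈ U.weightSpace ω (k - i) := by
  induction i with
  | zero => simpa using hv
  | succ i ih =>
    rw [pow_succ', Module.End.mul_apply]
    convert hV.vir_mem ih 1 using 2
    push_cast
    ring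

/-- Commutator formula for `ω(1)`, with the `ω(0)v = L(-1)v` term evaluated by the derivative axiom.
-/
lemma vir_zero_comm (v w : V) (n : ℤ) :
    U.vir ω 0 (U.mode v n w) = U.mode v n (U.vir ω 0 w) + U.mode (U.vir ω 0 v) n w
      - ((n : ℂ) + 1) • U.mode v n w := by
  have h := U.commutator_one ω v w n
  have hd := LinearMap.congr_fun (hV.derivative v (n + 1)) w
  have h0 : U.vir ω (-1) = U.mode ω 0 := by simp [vir]
  have h1 : U.vir ω 0 = U.mode ω 1 := by simp [vir]
  rw [h0] at hd
  rw [h1]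
  rw [hd, LinearMap.smul_apply, add_sub_cancel_right] at h
  rw [eq_sub_iff_add_eq'] at h
  rw [← h]
  push_cast
  module

lemma mode_mem {a b : ℤ} {u v : V} (hu : u ∈ U.weightSpace ω a) (hv : v ∈ U.weightSpace ω b)
    (n : ℤ) : U.mode u n v ∈ U.weightSpace ω (a + b - n - 1) := by
  rw [mem_weightSpace] at *
  rw [hV.vir_zero_comm, hu, hv, map_smul, mode_smul, LinearMap.smul_apply]
  push_cast
  module

lemma conformal_mem : ω ∈ U.weightSpace ω 2 := by
  have h := hV.vir_mem (vac_mem_weightSpace ω) (-2)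
  rwa [vir_neg_two_vac] at h

/-- Since `ω = L(-2)1`, moving `L(1)` to the right leaves only `L(1)1` and `L(-1)1`. This makes `ω`
quasi-primary, so that `L(n)` has adjoint `L(-n)`. -/
lemma vir_one_conformal : U.vir ω 1 ω = 0 := by
  have h := hV.vir_comm 1 (-2) (by norm_num) U.vac
  rw [vir_neg_two_vac, vir_apply_vac ω (by norm_num), map_zero] at h
  simpa [vir_apply_vac] using h

/-- An eigenvalue of `L(0)` is an integer. -/
lemma exists_int_of_eigenspace_ne_bot {p : ℂ} (hp : (U.vir ω 0).eigenspace p ≠ ⊥) :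
    ∃ n : ℤ, p = n := by
  by_contra! hn
  apply hp
  have h := (iSupIndep_def.1 (U.vir ω 0).eigenspaces_iSupIndep) p
  rw [top_unique (a := ⨆ j, ⨆ (_ : j ≠ p), (U.vir ω 0).eigenspace j), disjoint_top] at h
  · exact h
  · rw [← hV.iSup_weightSpace]
    exact iSup_le fun n => le_iSup_of_le (n : ℂ) (le_iSup_of_le (hn n).symm le_rfl)

/-- The `sl₂`-argument: a vector of minimal negative weight would generate `L(-1)`-descendants
up to weight zero, where the vacuum is killed by `L(1)`. -/
lemma isNGraded_of_isCFTType (h0 : U.IsCFTType ω) : U.IsNGraded ω := by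
  obtain ⟨N, hN⟩ := hV.bounded
  by_contra hcon
  obtain ⟨n₀, hn₀, hb₀⟩ : ∃ n : ℤ, n < 0 ∧ U.weightSpace ω n ≠ ⊥ := by
    simpa [IsNGraded] using hcon
  obtain ⟨n, ⟨hn, hb⟩, hmin⟩ := Int.exists_least_of_bdd
    (P := fun n => n < 0 ∧ U.weightSpace ω n ≠ ⊥)
    ⟨N, fun z hz => not_lt.1 fun hlt => hz.2 (hN z hlt)⟩ ⟨n₀, hn₀, hb₀⟩
  obtain ⟨v, hv, hv0⟩ := Submodule.exists_mem_ne_zero_of_ne_bot hb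
  have hlow : U.vir ω 1 v = 0 := by
    have hm := hV.vir_mem hv 1
    have : U.weightSpace ω (n - 1) = ⊥ := by
      by_contra hne
      have := hmin _ ⟨by omega, hne⟩
      omega
    rwa [this, Submodule.mem_bot] at hm
  have hwt : ∀ k : ℕ, (U.vir ω (-1) ^ k) v ∈ U.weightSpace ω (n + k) := by
    intro k
    induction k with
    | zero => simpa using hv
    | succ k ih =>
      rw [pow_succ', Module.End.mul_apply]
      convert hV.vir_mem ih (-1) using 2
      push_cast
      ring
  have hsl : ∀ k : ℕ, U.vir ω 1 ((U.vir ω (-1) ^ (k + 1)) v) =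
      (((k : ℂ) + 1) * (2 * n + k)) • (U.vir ω (-1) ^ k) v := by
    intro k
    induction k with
    | zero =>
      rw [pow_succ', Module.End.mul_apply, hV.vir_one_comm]
      simp [hlow, mem_weightSpace.1 hv, smul_smul]
    | succ k ih =>
      rw [pow_succ', Module.End.mul_apply, hV.vir_one_comm, ih, map_smul,
        ← Module.End.mul_apply, ← pow_succ', mem_weightSpace.1 (hwt (k + 1))]
      push_cast
      module
  have hne : ∀ k : ℕ, (k : ℤ) ≤ -n → (U.vir ω (-1) ^ k) v ≠ 0 := by
    intro k
    induction k with
    | zero => intro _; simpa using hv0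
    | succ k ih =>
      intro hk hz
      have h1 := hsl k
      rw [hz, map_zero, eq_comm, smul_eq_zero] at h1
      rcases h1 with h1 | h1
      -- The scalar cannot vanish: `k + 1 ≤ -n` gives `2n + k < n < 0`.
      · have h2 : (((k : ℤ) + 1) * (2 * n + k) : ℤ) = 0 := by exact_mod_cast h1
        rcases mul_eq_zero.1 h2 with h3 | h3 <;> push_cast at hk <;> omega
      · exact ih (by push_cast at hk; omega) h1
  -- With this `k` the descendant `L(-1)^(k+1) v` has weight zero, hence is a multiple of the
  -- vacuum.
  obtain ⟨k, hk⟩ : ∃ k : ℕ, (k : ℤ) + 1 = -n := ⟨(-n - 1).toNat, by omega⟩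
  have hz : U.vir ω 1 ((U.vir ω (-1) ^ (k + 1)) v) = 0 := by
    have hm := hwt (k + 1)
    rw [show n + ((k + 1 : ℕ) : ℤ) = 0 by push_cast; omega, h0,
      Submodule.mem_span_singleton] at hm
    obtain ⟨c, hc⟩ := hm
    rw [← hc, map_smul, vir_apply_vac ω (by norm_num), smul_zero]
  rw [hsl, smul_eq_zero] at hz
  rcases hz with h1 | h1
  · have h2 : (((k : ℤ) + 1) * (2 * n + k) : ℤ) = 0 := by exact_mod_cast h1
    rcases mul_eq_zero.1 h2 with h3 | h3 <;> omega
  · exact hne k (by omega) h1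

end IsVOA

/-! ### Invariant forms: adjoints and radicals -/

namespace IsInvariant

variable {ω : V} {B : LinearMap.BilinForm ℂ V} (hB : U.IsInvariant ω B)

include hB

/-- The adjoint of a mode of a quasi-primary vector. -/
lemma apply_mode_of_quasiPrimary {k : ℤ} {u : V} (hu : u ∈ U.weightSpace ω k)
    (h1 : U.vir ω 1 u = 0) (n : ℤ) (v w : V) :
    B (U.mode u n v) w = (-1 : ℂ) ^ k * B v (U.mode u (2 * k - n - 2) w) := by
  rw [hB k u hu, finsum_eq_single _ 0]
  · simp
  · intro i hi
    obtain ⟨j, rfl⟩ := Nat.exists_eq_succ_of_ne_zero hi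
    simp [pow_succ, h1, mode_zero]

lemma apply_vir (hV : U.IsVOA ω) (n : ℤ) (v w : V) :
    B (U.vir ω n v) w = B v (U.vir ω (-n) w) := by
  rw [vir, hB.apply_mode_of_quasiPrimary hV.conformal_mem hV.vir_one_conformal, vir]
  norm_num
  congr 3
  ring

lemma apply_eq_zero_of_ne (hV : U.IsVOA ω) {m n : ℤ} (hmn : m ≠ n) {v w : V}
    (hv : v ∈ U.weightSpace ω m) (hw : w ∈ U.weightSpace ω n) : B v w = 0 := by
  have h := hB.apply_vir hV 0 v w
  rw [neg_zero, mem_weightSpace.1 hv, mem_weightSpace.1 hw, map_smul, map_smul,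
    LinearMap.smul_apply, smul_eq_mul, smul_eq_mul, ← sub_eq_zero, ← sub_mul, mul_eq_zero,
    sub_eq_zero] at h
  exact h.resolve_left fun h' => hmn (by exact_mod_cast h')

/-- The left radical of a nonzero invariant form on a simple VOA vanishes. -/
lemma eq_zero_of_apply_left (hV : U.IsVOA ω) (hs : U.IsSimple) (hB0 : B ≠ 0) {v : V}
    (hv : ∀ w, B v w = 0) : v = 0 := by
  have hinv : ∀ (u : V) (n : ℤ), ∀ x ∈ LinearMap.ker B, U.mode u n x ∈ LinearMap.ker B := by
    intro u n x hx
    have hu : u ∈ ⨆ n, U.weightSpace ω n := hV.iSup_weightSpace ▸ Submodule.mem_top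
    induction hu using Submodule.iSup_induction' with
    | mem k u hu =>
      ext w
      rw [hB k u hu, LinearMap.mem_ker.1 hx]
      simp
    | zero => simp [mode_zero]
    | add u u' _ _ h h' =>
      rw [mode_add]
      exact add_mem h h'
  rcases hs.2 _ hinv with h | h
  · rw [← Submodule.mem_bot ℂ, ← h]
    exact LinearMap.ext hv
  · exact absurd (LinearMap.ker_eq_top.1 h) hB0

/-- The right radical of a nonzero invariant form on a simple VOA vanishes. -/
lemma eq_zero_of_apply_right (hV : U.IsVOA ω) (hs : U.IsSimple) (hB0 : B ≠ 0) {w : V}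
    (hw : ∀ v, B v w = 0) : w = 0 := by
  obtain ⟨N, hN⟩ := hV.bounded
  -- Invariance expresses the left action through the right one, so it is inverted by induction on
  -- the weight of `u`, starting at the lower bound `N`. At mode `2k - n - 2` the `i = 0` term is
  -- `u(n)x`; the others involve `L(1)^i u`, of smaller weight.
  have hhom : ∀ (d : ℕ) (k : ℤ), k < N + d → ∀ u ∈ U.weightSpace ω k, ∀ (n : ℤ) (x : V),
      (∀ v, B v x = 0) → ∀ v, B v (U.mode u n x) = 0 := by
    intro d
    induction d with
    | zero =>
      intro k hk u hu n x _ v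
      rw [hN k (by simpa using hk), Submodule.mem_bot] at hu
      simp [hu, mode_zero]
    | succ d ih =>
      intro k hk u hu n x hx v
      have h := hB k u hu (2 * k - n - 2) v x
      rw [show 2 * k - (2 * k - n - 2) - 2 = n by ring, hx, finsum_eq_single _ 0] at h
      · have hk0 : ((-1 : ℂ) ^ k) ≠ 0 := zpow_ne_zero _ (by norm_num)
        simpa [hk0] using h
      · intro i hi
        rw [ih (k - i) (by push_cast at hk; omega) _ (hV.pow_vir_one_mem hu i) _ x hx, mul_zero]
  have hinv : ∀ (u : V) (n : ℤ), ∀ x ∈ LinearMap.ker B.flip,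
      U.mode u n x ∈ LinearMap.ker B.flip := by
    intro u n x hx
    have hu : u ∈ ⨆ n, U.weightSpace ω n := hV.iSup_weightSpace ▸ Submodule.mem_top
    induction hu using Submodule.iSup_induction' with
    | mem k u hu =>
      exact LinearMap.ext fun v => hhom (k - N + 1).toNat k (by omega) u hu n x
        (fun v => LinearMap.congr_fun hx v) v
    | zero => simp [mode_zero]
    | add u u' _ _ h h' =>
      rw [mode_add]
      exact add_mem h h'
  rcases hs.2 _ hinv with h | h
  · rw [← Submodule.mem_bot ℂ, ← h]
    exact LinearMap.ext hw
  · refine absurd (LinearMap.ext₂ fun v x => ?_) hB0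
    have hx : x ∈ LinearMap.ker B.flip := h ▸ Submodule.mem_top
    exact LinearMap.congr_fun hx v

/-- If weight zero is spanned by the vacuum then `L(1)` annihilates weight one. -/
lemma vir_one_eq_zero (hV : U.IsVOA ω) (hs : U.IsSimple) (hB0 : B ≠ 0) (h0 : U.IsCFTType ω)
    {u : V} (hu : u ∈ U.weightSpace ω 1) : U.vir ω 1 u = 0 := by
  have := hs.1
  -- The vacuum pairs trivially with every nonzero weight, and weight zero is its own line; if it
  -- were isotropic it would lie in the radical.
  have hvv : B U.vac U.vac ≠ 0 := by
    intro hz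
    refine U.vac_ne_zero (hB.eq_zero_of_apply_left hV hs hB0 fun w => ?_)
    have hw : w ∈ ⨆ n, U.weightSpace ω n := hV.iSup_weightSpace ▸ Submodule.mem_top
    induction hw using Submodule.iSup_induction' with
    | mem n w hw =>
      rcases eq_or_ne 0 n with rfl | hn
      · rw [h0, Submodule.mem_span_singleton] at hw
        obtain ⟨c, rfl⟩ := hw
        rw [map_smul, hz, smul_zero]
      · exact hB.apply_eq_zero_of_ne hV hn (vac_mem_weightSpace ω) hw
    | zero => exact map_zero _
    | add w w' _ _ h h' => rw [map_add, h, h', add_zero]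
  have hm := hV.vir_mem hu 1
  rw [sub_self, h0, Submodule.mem_span_singleton] at hm
  obtain ⟨c, hc⟩ := hm
  have h := hB.apply_vir hV 1 u U.vac
  rw [← hc, map_smul, LinearMap.smul_apply, vir_apply_vac ω le_rfl, map_zero, smul_eq_mul,
    mul_eq_zero] at h
  rw [← hc, h.resolve_right hvv, zero_smul]

/-- On an `ℕ`-graded VOA, multiplication by a weight zero state is self-adjoint. -/
lemma apply_mode_neg_one (hV : U.IsVOA ω) (hN : U.IsNGraded ω) {a : V}
    (ha : a ∈ U.weightSpace ω 0) (v w : V) :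
    B (U.mode a (-1) v) w = B v (U.mode a (-1) w) := by
  have h1 : U.vir ω 1 a = 0 := by
    have hm := hV.vir_mem ha 1
    rwa [hN _ (by norm_num), Submodule.mem_bot] at hm
  rw [hB.apply_mode_of_quasiPrimary ha h1]
  simp

end IsInvariant

lemma iSupIndep_deRham (ω' h : V) : iSupIndep (U.deRham ω' h) :=
  (U.mode h 0).eigenspaces_iSupIndep.mono fun _ => inf_le_right

/-! ### The shifted grading on the weight zero space -/

namespace IsShiftedTriple

variable {ω' h : V} (hT : U.IsShiftedTriple ω' h)

include hT

lemma vir_shift (n : ℤ) (v : V) :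
    U.vir (U.shift ω' h) n v = U.vir ω' n v - ((n : ℂ) + 1) • U.mode h n v := by
  rw [vir, shift, mode_add, hT.isVOA_W.derivative, add_sub_cancel_right, LinearMap.add_apply,
    LinearMap.smul_apply, vir]
  push_cast
  module

lemma vir_shift_zero (v : V) :
    U.vir (U.shift ω' h) 0 v = U.vir ω' 0 v - U.mode h 0 v := by
  simp [hT.vir_shift]

lemma nGraded_W : U.IsNGraded ω' :=
  hT.isVOA_W.isNGraded_of_isCFTType hT.cftType_W

lemma exists_mode_one : ∃ ν : ℂ, U.mode h 1 h = (ν / 2) • U.vac := by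
  have hm := hT.isVOA_W.mode_mem hT.mem_W_one hT.mem_W_one 1
  rw [show (1 + 1 - 1 - 1 : ℤ) = 0 by norm_num, hT.cftType_W, Submodule.mem_span_singleton] at hm
  obtain ⟨c, hc⟩ := hm
  exact ⟨2 * c, by rw [← hc]; congr 1; ring⟩

/-- Applying `[h(-1), h(0)]` to the vacuum shows `h(0)h = -h(0)h`: the `i = 1` term is a multiple of
`1(-2)1 = 0`, and for `i ≥ 2` the state `h(i)h` has negative weight. -/
lemma mode_zero_self : U.mode h 0 h = 0 := by
  obtain ⟨ν, hν⟩ := hT.exists_mode_one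
  have h1 := U.commutator_zero h h U.vac (-1)
  have h2 := U.commutator h h U.vac (-1) 0
  rw [finsum_eq_single _ 0] at h2
  · simp only [Ring.choose_zero_right, Nat.cast_zero, one_smul, mode_apply_vac, sub_zero,
      add_zero] at h1 h2
    rw [U.mode_apply_vac_of_nonneg h le_rfl, map_zero] at h1 h2
    rw [zero_sub] at h2
    have h3 : (2 : ℂ) • U.mode h 0 h = 0 := by
      rw [two_smul]
      nth_rewrite 1 [h2]
      exact neg_add_cancel _
    simpa using h3
  · intro i hi
    rcases eq_or_ne i 1 with rfl | hi1
    · rw [Nat.cast_one, hν, mode_smul, LinearMap.smul_apply, mode_vac]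
      simp
    · have hm := hT.isVOA_W.mode_mem hT.mem_W_one hT.mem_W_one i
      rw [hT.nGraded_W _ (by omega), Submodule.mem_bot] at hm
      rw [hm, mode_zero, LinearMap.zero_apply, smul_zero]

lemma mem_V_one : h ∈ U.weightSpace (U.shift ω' h) 1 := by
  rw [mem_weightSpace, hT.vir_shift_zero, hT.mode_zero_self, sub_zero]
  exact mem_weightSpace.1 hT.mem_W_one

lemma vir_one_self {ν : ℂ} (hν : U.mode h 1 h = (ν / 2) • U.vac) :
    U.vir (U.shift ω' h) 1 h = -ν • U.vac := by
  obtain ⟨B, hB0, hB⟩ := hT.selfDual_W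
  rw [hT.vir_shift, hB.vir_one_eq_zero hT.isVOA_W hT.simple_V hB0 hT.cftType_W hT.mem_W_one, hν]
  push_cast
  module

lemma commute_mode_zero : Commute (U.vir ω' 0) (U.mode h 0) := by
  refine LinearMap.ext fun v => ?_
  have h1 := hT.isVOA_W.vir_zero_comm h v 0
  rw [mem_weightSpace.1 hT.mem_W_one, mode_smul] at h1
  simpa using h1

lemma commute_vir_shift : Commute (U.vir ω' 0) (U.vir (U.shift ω' h) 0) := by
  have : U.vir (U.shift ω' h) 0 = U.vir ω' 0 - U.mode h 0 := LinearMap.ext hT.vir_shift_zero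
  rw [this]
  exact (Commute.refl _).sub_right hT.commute_mode_zero

lemma mem_deRham {p : ℂ} {v : V} :
    v ∈ U.deRham ω' h p ↔ U.vir ω' 0 v = p • v ∧ U.mode h 0 v = p • v := by
  rw [deRham, Submodule.mem_inf, mem_weightSpace_zero, hT.vir_shift_zero, mem_eigenspace_iff,
    sub_eq_zero]
  constructor
  · rintro ⟨h1, h2⟩
    exact ⟨h1.trans h2, h2⟩
  · rintro ⟨h1, h2⟩
    exact ⟨h1.trans h2.symm, h2⟩

lemma deRham_eq_jointEigenspace (p : ℂ) : U.deRham ω' h p = U.jointEigenspace ω' h p p := by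
  ext v
  rw [hT.mem_deRham, jointEigenspace, Submodule.mem_inf, mem_eigenspace_iff, mem_eigenspace_iff]

lemma mode_zero_mem {v : V} (hv : v ∈ U.weightSpace (U.shift ω' h) 0) :
    U.mode h 0 v ∈ U.weightSpace (U.shift ω' h) 0 := by
  simpa using hT.isVOA_V.mode_mem hT.mem_V_one hv 0

lemma iSup_deRham : ⨆ p, U.deRham ω' h p = U.weightSpace (U.shift ω' h) 0 := by
  refine le_antisymm (iSup_le fun p => inf_le_left) ?_
  -- Decompose the kernel of the shifted `L(0)` under `L'(0)`; there `h(0)` has the same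
  -- eigenvalues.
  refine (eigenspace_le_iSup_inf_of_commute hT.commute_vir_shift
    hT.isVOA_W.iSup_eigenspace _).trans (iSup_mono fun p v hv => ?_)
  have h1 := mem_eigenspace_iff.1 hv.1
  have h2 := mem_weightSpace_zero.1 hv.2
  rw [hT.vir_shift_zero, sub_eq_zero] at h2
  exact hT.mem_deRham.2 ⟨h1, h2.symm.trans h1⟩

lemma exists_nat_of_deRham_ne_bot {p : ℂ} (hp : U.deRham ω' h p ≠ ⊥) : ∃ n : ℕ, p = n := by
  have hp' : (U.vir ω' 0).eigenspace p ≠ ⊥ := by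
    refine fun hbot => hp (eq_bot_mono (fun v hv => ?_) hbot)
    exact mem_eigenspace_iff.2 (hT.mem_deRham.1 hv).1
  obtain ⟨n, rfl⟩ := hT.isVOA_W.exists_int_of_eigenspace_ne_bot hp'
  rcases lt_or_ge n 0 with hn | hn
  · exact absurd (hT.nGraded_W n hn) hp'
  · lift n to ℕ using hn
    exact ⟨n, by simp⟩

lemma vac_mem_deRham : U.vac ∈ U.deRham ω' h 0 :=
  hT.mem_deRham.2 ⟨by rw [vir_apply_vac ω' (by norm_num), zero_smul],
    by rw [U.mode_apply_vac_of_nonneg h le_rfl, zero_smul]⟩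

lemma deRham_zero : U.deRham ω' h 0 = Submodule.span ℂ {U.vac} := by
  refine le_antisymm (fun v hv => ?_) ?_
  · rw [← hT.cftType_W, mem_weightSpace_zero, (hT.mem_deRham.1 hv).1, zero_smul]
  · rw [Submodule.span_singleton_le_iff_mem]
    exact hT.vac_mem_deRham

lemma mode_mem_deRham {p q : ℂ} {a b : V} (ha : a ∈ U.deRham ω' h p) (hb : b ∈ U.deRham ω' h q) :
    U.mode a (-1) b ∈ U.deRham ω' h (p + q) := by
  refine ⟨?_, ?_⟩
  · simpa using hT.isVOA_V.mode_mem ha.1 hb.1 (-1)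
  · have h1 := U.commutator_zero h a b (-1)
    rw [eq_sub_iff_add_eq] at h1
    refine mem_eigenspace_iff.2 ?_
    rw [← h1, (hT.mem_deRham.1 ha).2, (hT.mem_deRham.1 hb).2, mode_smul,
      map_smul, LinearMap.smul_apply, add_smul]

/-! ### Duality between the eigenspaces -/

section Form

variable {ν : ℂ} (hν : U.mode h 1 h = (ν / 2) • U.vac) {B : LinearMap.BilinForm ℂ V}
  (hB : U.IsInvariant (U.shift ω' h) B)

include hν hB

/-- Only `i = 0, 1` survive in the invariance sum, because `L(1)h` is a multiple of the vacuum and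
`L(1)1 = 0`. The `i = 1` term yields `ν`. -/
lemma apply_mode_zero (v w : V) : B (U.mode h 0 v) w = -B v (U.mode h 0 w) + ν * B v w := by
  rw [hB 1 h hT.mem_V_one, finsum_eq_sum_of_support_subset (s := {0, 1})]
  · rw [Finset.sum_pair zero_ne_one]
    have h1 : U.mode (-ν • U.vac) (-1) w = -ν • w := by
      rw [mode_smul, LinearMap.smul_apply, mode_vac, if_pos rfl]
    simp [hT.vir_one_self hν, -neg_smul, h1]
  · intro i hi
    by_contra hi'
    apply hi
    simp only [Finset.coe_insert, Finset.coe_singleton, Set.mem_insert_iff,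
      Set.mem_singleton_iff] at hi'
    obtain ⟨j, rfl⟩ : ∃ j, i = j + 2 := ⟨i - 2, by omega⟩
    have : (U.vir (U.shift ω' h) 1 ^ (j + 2)) h = 0 := by
      rw [pow_add, pow_two, Module.End.mul_apply, Module.End.mul_apply, hT.vir_one_self hν,
        map_smul, vir_apply_vac _ (by norm_num), smul_zero, map_zero]
    simp only [this, mode_zero, LinearMap.zero_apply, map_zero, mul_zero]

lemma apply_eq_zero_of_add_ne {p q : ℂ} (hpq : p + q ≠ ν) {a b : V} (ha : a ∈ U.deRham ω' h p)
    (hb : b ∈ U.deRham ω' h q) : B a b = 0 := by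
  have h1 := hT.apply_mode_zero hν hB a b
  rw [(hT.mem_deRham.1 ha).2, (hT.mem_deRham.1 hb).2, map_smul, map_smul, LinearMap.smul_apply,
    smul_eq_mul, smul_eq_mul] at h1
  have h2 : (p + q - ν) * B a b = 0 := by linear_combination h1
  exact (mul_eq_zero.1 h2).resolve_left (sub_ne_zero.2 hpq)

variable (hB0 : B ≠ 0)

include hB0

/-- All other weights, and all other degrees in `V_0`, are orthogonal to `a`; failure here would put
`a` in the radical. -/
lemma exists_apply_ne_zero_left {p : ℂ} {a : V} (ha : a ∈ U.deRham ω' h p) (ha0 : a ≠ 0) :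
    ∃ b ∈ U.deRham ω' h (ν - p), B a b ≠ 0 := by
  by_contra! hz
  refine ha0 (hB.eq_zero_of_apply_left hT.isVOA_V hT.simple_V hB0 fun w => ?_)
  have hw : w ∈ ⨆ n, U.weightSpace (U.shift ω' h) n :=
    hT.isVOA_V.iSup_weightSpace ▸ Submodule.mem_top
  induction hw using Submodule.iSup_induction' with
  | mem n w hw =>
    rcases eq_or_ne 0 n with rfl | hn
    · rw [← hT.iSup_deRham] at hw
      induction hw using Submodule.iSup_induction' with
      | mem q w hw =>
        rcases eq_or_ne (p + q) ν with rfl | hq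
        · exact hz w (by simpa using hw)
        · exact hT.apply_eq_zero_of_add_ne hν hB hq ha hw
      | zero => exact map_zero _
      | add w w' _ _ h h' => rw [map_add, h, h', add_zero]
    · exact hB.apply_eq_zero_of_ne hT.isVOA_V hn ha.1 hw
  | zero => exact map_zero _
  | add w w' _ _ h h' => rw [map_add, h, h', add_zero]

lemma exists_apply_ne_zero_right {q : ℂ} {b : V} (hb : b ∈ U.deRham ω' h q) (hb0 : b ≠ 0) :
    ∃ a ∈ U.deRham ω' h (ν - q), B a b ≠ 0 := by
  by_contra! hz
  refine hb0 (hB.eq_zero_of_apply_right hT.isVOA_V hT.simple_V hB0 fun w => ?_)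
  have hw : w ∈ ⨆ n, U.weightSpace (U.shift ω' h) n :=
    hT.isVOA_V.iSup_weightSpace ▸ Submodule.mem_top
  induction hw using Submodule.iSup_induction' with
  | mem n w hw =>
    rcases eq_or_ne n 0 with rfl | hn
    · rw [← hT.iSup_deRham] at hw
      induction hw using Submodule.iSup_induction' with
      | mem p w hw =>
        rcases eq_or_ne (p + q) ν with rfl | hp
        · exact hz w (by simpa using hw)
        · exact hT.apply_eq_zero_of_add_ne hν hB hp hw hb
      | zero => exact LinearMap.map_zero₂ _ _
      | add w w' _ _ h h' => rw [LinearMap.map_add₂, h, h', add_zero]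
    · exact hB.apply_eq_zero_of_ne hT.isVOA_V hn hw hb.1
  | zero => exact LinearMap.map_zero₂ _ _
  | add w w' _ _ h h' => rw [LinearMap.map_add₂, h, h', add_zero]

lemma isPerfPair_deRham {p q : ℂ} (hpq : p + q = ν) :
    (B.domRestrict₁₂ (U.deRham ω' h p) (U.deRham ω' h q)).IsPerfPair := by
  have := hT.isVOA_V.finite 0
  have : FiniteDimensional ℂ (U.deRham ω' h p) :=
    Submodule.finiteDimensional_of_le (S₂ := U.weightSpace (U.shift ω' h) 0) inf_le_left
  subst hpq
  refine .of_injective ?_ ?_ <;> rw [injective_iff_map_eq_zero]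
  · rintro ⟨a, ha⟩ h0
    by_contra ha0
    obtain ⟨b, hb, hab⟩ := hT.exists_apply_ne_zero_left hν hB hB0 ha (by simpa using ha0)
    exact hab (LinearMap.congr_fun h0 ⟨b, by simpa using hb⟩)
  · rintro ⟨b, hb⟩ h0
    by_contra hb0
    obtain ⟨a, ha, hab⟩ := hT.exists_apply_ne_zero_right hν hB hB0 hb (by simpa using hb0)
    exact hab (LinearMap.congr_fun h0 ⟨a, by simpa using ha⟩)

end Form

/-! ### The top degree and the minimal ideal -/

variable {ν : ℂ} (hν : U.mode h 1 h = (ν / 2) • U.vac)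

include hν

/-- `A^ν` is one-dimensional, being dual to `A^0`. -/
lemma exists_deRham_eq_span : ∃ t : V, t ≠ 0 ∧ U.deRham ω' h ν = Submodule.span ℂ {t} := by
  have := hT.simple_V.1
  obtain ⟨B, hB0, hB⟩ := hT.selfDual_V
  obtain ⟨t, ht, hvt⟩ :=
    hT.exists_apply_ne_zero_left hν hB hB0 hT.vac_mem_deRham U.vac_ne_zero
  rw [sub_zero] at ht
  refine ⟨t, fun h0 => hvt (by rw [h0, map_zero]), le_antisymm (fun x hx => ?_)
    ((Submodule.span_singleton_le_iff_mem _ _).2 ht)⟩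
  rw [Submodule.mem_span_singleton]
  -- The coefficient makes the difference orthogonal to `A^0`, the only degree that could pair with
  -- it.
  refine ⟨B U.vac x / B U.vac t, ?_⟩
  by_contra hne
  obtain ⟨a, ha, hab⟩ := hT.exists_apply_ne_zero_right hν hB hB0
    (sub_mem hx (Submodule.smul_mem _ (B U.vac x / B U.vac t) ht)) (sub_ne_zero.2 (Ne.symm hne))
  rw [sub_self, hT.deRham_zero, Submodule.mem_span_singleton] at ha
  obtain ⟨c, rfl⟩ := ha
  apply hab
  rw [LinearMap.map_smul₂, map_sub, map_smul, smul_eq_mul, smul_eq_mul, div_mul_cancel₀ _ hvt,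
    sub_self, mul_zero]

lemma deRham_add_eq_bot {k : ℕ} (hk : k ≠ 0) : U.deRham ω' h (k + ν) = ⊥ := by
  by_contra hne
  obtain ⟨B, hB0, hB⟩ := hT.selfDual_V
  obtain ⟨y, hy, hy0⟩ := Submodule.exists_mem_ne_zero_of_ne_bot hne
  obtain ⟨b, hb, hyb⟩ := hT.exists_apply_ne_zero_left hν hB hB0 hy hy0
  obtain ⟨m, hm⟩ := hT.exists_nat_of_deRham_ne_bot (p := ν - (k + ν))
    ((Submodule.ne_bot_iff _).2 ⟨b, hb, fun h0 => hyb (by rw [h0, map_zero])⟩)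
  have : ((k + m : ℕ) : ℂ) = 0 := by
    push_cast
    linear_combination -hm
  have : k + m = 0 := by exact_mod_cast this
  omega

lemma isZeroIdeal_deRham : U.IsZeroIdeal (U.shift ω' h) (U.deRham ω' h ν) := by
  refine ⟨inf_le_left, fun a ha x hx => ?_⟩
  rw [← hT.iSup_deRham] at ha
  induction ha using Submodule.iSup_induction' with
  | mem p a ha =>
    rcases eq_or_ne a 0 with rfl | ha0
    · simp [mode_zero]
    obtain ⟨n, rfl⟩ := hT.exists_nat_of_deRham_ne_bot ((Submodule.ne_bot_iff _).2 ⟨a, ha, ha0⟩)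
    have h1 := hT.mode_mem_deRham ha hx
    have h2 := hT.mode_mem_deRham hx ha
    rw [add_comm] at h2
    have hle : U.deRham ω' h (n + ν) ≤ U.deRham ω' h ν := by
      rcases eq_or_ne n 0 with rfl | hn
      · simp
      · rw [hT.deRham_add_eq_bot hν hn]
        exact bot_le
    exact ⟨hle h1, hle h2⟩
  | zero => simp [mode_zero]
  | add a a' _ _ h h' =>
    rw [mode_add, map_add]
    exact ⟨add_mem h.1 h'.1, add_mem h.2 h'.2⟩

/-- Every nonzero ideal contains `A^ν`: multiply a nonzero element by a state dual to its
component of lowest degree. -/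
lemma deRham_le_of_isZeroIdeal {I : Submodule ℂ V} (hI : U.IsZeroIdeal (U.shift ω' h) I)
    (hI0 : I ≠ ⊥) : U.deRham ω' h ν ≤ I := by
  obtain ⟨B, hB0, hB⟩ := hT.selfDual_V
  obtain ⟨x, hx, hx0⟩ := Submodule.exists_mem_ne_zero_of_ne_bot hI0
  -- Reindexing by `ℕ` gives ordered degrees, so a lowest component can be chosen.
  have hx' : x ∈ ⨆ n : ℕ, U.deRham ω' h n := by
    refine (?_ : U.weightSpace (U.shift ω' h) 0 ≤ _) (hI.1 hx)
    rw [← hT.iSup_deRham]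
    refine iSup_le fun p => ?_
    by_cases hp : U.deRham ω' h p = ⊥
    · rw [hp]
      exact bot_le
    · obtain ⟨n, rfl⟩ := hT.exists_nat_of_deRham_ne_bot hp
      exact le_iSup (fun n : ℕ => U.deRham ω' h n) n
  obtain ⟨f, hf, hfx⟩ := (Submodule.mem_iSup_iff_exists_finsupp _ _).1 hx'
  have hne : f.support.Nonempty := by
    rw [Finsupp.support_nonempty_iff]
    rintro rfl
    exact hx0 (by simpa using hfx.symm)
  obtain ⟨n, hn, hmin⟩ := f.support.exists_minimal hne
  obtain ⟨y, hy, hny⟩ :=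
    hT.exists_apply_ne_zero_left hν hB hB0 (hf n) (Finsupp.mem_support_iff.1 hn)
  have hxy : U.mode x (-1) y = U.mode (f n) (-1) y := by
    have hlin : ∀ u, U.mode u (-1) y = (LinearMap.applyₗ y ∘ₗ LinearMap.proj (-1) ∘ₗ
        VertexOperator.ncoeff ∘ₗ U.Y) u := fun u => rfl
    rw [← hfx, hlin, hlin, map_finsuppSum, Finsupp.sum, Finset.sum_eq_single_of_mem n hn]
    intro m hm hmn
    have hlt : n < m := lt_of_le_of_ne (not_lt.1 fun hlt => absurd (hmin hm hlt.le) (not_le.2 hlt))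
      (Ne.symm hmn)
    have hmem := hT.mode_mem_deRham (hf m) hy
    obtain ⟨k, rfl⟩ := Nat.exists_eq_add_of_lt hlt
    rwa [show ((n + k + 1 : ℕ) : ℂ) + (ν - n) = ((k + 1 : ℕ) : ℂ) + ν by push_cast; ring,
      hT.deRham_add_eq_bot hν k.succ_ne_zero, Submodule.mem_bot] at hmem
  have hmem : U.mode x (-1) y ∈ U.deRham ω' h ν := by
    rw [hxy]
    simpa using hT.mode_mem_deRham (hf n) hy
  -- Self-adjointness turns `B (f n) y` into the pairing of the vacuum with this product.
  have hne0 : U.mode x (-1) y ≠ 0 := by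
    intro h0
    apply hny
    have h1 := hB.apply_mode_neg_one hT.isVOA_V hT.nGraded_V (hf n).1 U.vac y
    rwa [mode_apply_vac, ← hxy, h0, map_zero] at h1
  obtain ⟨t, -, ht⟩ := hT.exists_deRham_eq_span hν
  rw [ht, Submodule.mem_span_singleton] at hmem
  obtain ⟨c, hc⟩ := hmem
  have hc0 : c ≠ 0 := fun h0 => hne0 (by rw [← hc, h0, zero_smul])
  rw [ht, Submodule.span_singleton_le_iff_mem, ← Submodule.smul_mem_iff _ hc0, hc]
  exact (hI.2 y hy.1 x hx).2

lemma isLeast_deRham :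
    IsLeast {I : Submodule ℂ V | U.IsZeroIdeal (U.shift ω' h) I ∧ I ≠ ⊥} (U.deRham ω' h ν) := by
  refine ⟨⟨hT.isZeroIdeal_deRham hν, ?_⟩, fun I hI => hT.deRham_le_of_isZeroIdeal hν hI.1 hI.2⟩
  obtain ⟨t, ht0, ht⟩ := hT.exists_deRham_eq_span hν
  rwa [ht, Ne, Submodule.span_singleton_eq_bot]

end IsShiftedTriple

end VertexAlgebra

theorem theorem5p1 {V : Type*} [AddCommGroup V] [Module ℂ V]
    (U : VertexAlgebra V) (ω' h : V) (hT : U.IsShiftedTriple ω' h) :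
    -- `A^p` is the `p`-eigenspace of `h(0)` on `V_0`, and it equals `W_{p,p}`
    (∀ v ∈ U.weightSpace (U.shift ω' h) 0, U.mode h 0 v ∈ U.weightSpace (U.shift ω' h) 0) ∧
    (∀ p : ℂ, U.deRham ω' h p = U.jointEigenspace ω' h p p) ∧
    -- (i)
    iSupIndep (U.deRham ω' h) ∧
    (⨆ p : ℂ, U.deRham ω' h p) = U.weightSpace (U.shift ω' h) 0 ∧
    (∀ p : ℂ, U.deRham ω' h p ≠ ⊥ → ∃ n : ℕ, p = n) ∧
    -- (ii)
    U.deRham ω' h 0 = Submodule.span ℂ {U.vac} ∧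
    -- (iv)
    (∀ p q : ℂ, ∀ a ∈ U.deRham ω' h p, ∀ b ∈ U.deRham ω' h q,
      U.mode a (-1) b ∈ U.deRham ω' h (p + q)) ∧
    -- the scalar `ν`
    (∃ ν : ℂ, U.mode h 1 h = (ν / 2) • U.vac) ∧
    ∀ ν : ℂ, U.mode h 1 h = (ν / 2) • U.vac →
      -- (iii) `A^ν` is the least nonzero ideal of `V_0`, and it is one-dimensional
      IsLeast {I : Submodule ℂ V | U.IsZeroIdeal (U.shift ω' h) I ∧ I ≠ ⊥} (U.deRham ω' h ν) ∧
      (∃ t : V, t ≠ 0 ∧ U.deRham ω' h ν = Submodule.span ℂ {t}) ∧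
      ∀ B : LinearMap.BilinForm ℂ V, B ≠ 0 → U.IsInvariant (U.shift ω' h) B →
        -- (v)
        (∀ p q : ℂ, p + q ≠ ν → ∀ a ∈ U.deRham ω' h p, ∀ b ∈ U.deRham ω' h q, B a b = 0) ∧
        -- (vi)
        (∀ p q : ℂ, p + q = ν →
          (B.domRestrict₁₂ (U.deRham ω' h p) (U.deRham ω' h q)).IsPerfPair) :=
  ⟨fun _ hv => hT.mode_zero_mem hv, hT.deRham_eq_jointEigenspace, VertexAlgebra.iSupIndep_deRham ω' h,
    hT.iSup_deRham, fun _ hp => hT.exists_nat_of_deRham_ne_bot hp, hT.deRham_zero,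
    fun _ _ _ ha _ hb => hT.mode_mem_deRham ha hb, hT.exists_mode_one,
    fun _ hν => ⟨hT.isLeast_deRham hν, hT.exists_deRham_eq_span hν, fun _ hB0 hB =>
      ⟨fun _ _ hpq _ ha _ hb => hT.apply_eq_zero_of_add_ne hν hB hpq ha hb,
        fun _ _ hpq => hT.isPerfPair_deRham hν hB hB0 hpq⟩⟩⟩
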